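/- Let $m\ge 1$ be an odd integer, let $n$ be a natural number, and write $[n]=\{1,\dots,n\}$. Let $\mathcal{A}=\mathcal{D}-\mathcal{C}$ be a real tensor of order $m$ and dimension $n$, where $\mathcal{D}$ is a nonnegative diagonal tensor and $\mathcal{C}=(c_{i_1\cdots i_m})$ is an entrywise nonnegative tensor with zero diagonal entries $c_{ii\cdots i}=0$, $i\in[n]$; let $|\mathcal{A}|=(|a_{i_1\cdots i_m}|)$ be the absolute tensor of $\mathcal{A}$ (so $|\mathcal{A}|=\mathcal{D}+\mathcal{C}$). A real number $\mu$ is an H-eigenvalue of a tensor $\mathcal{T}=(t_{i_1\cdots i_m})$ if there is a nonzero $x\in\mathbb{R}^n$ with $$\sum_{i_2,\dots,i_m=1}^n t_{ii_2\cdots i_m}x_{i_2}\cdots x_{i_m}=\mu\, x_i^{m-1}\qquad\text{for all } i\in[n],$$ and $\lambda(\mathcal{T})$ denotes the largest H-eigenvalue of $\mathcal{T}$. In the degenerate case $m=1$ assume in addition that $\mathcal{A}$ has an H-eigenvalue (for $m\ge 3$ no such assumption is made). Suppose that $\mathcal{C}$ is weakly even-bipartite corresponding to a nonempty proper subset $V\subset[n]$,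 that is, $c_{i_1\cdots i_m}=0$ whenever the number of positions $j\in\{1,\dots,m\}$ with $i_j\in V$ is odd. Suppose moreover that for every $i\in[n]\setminus V$ $$c_{ii_2\cdots i_m}=0\qquad\text{for all } i_2,\dots,i_m\in[n].$$ Then $\mathcal{A}$ and $|\mathcal{A}|$ both have a largest H-eigenvalue, and $\lambda(\mathcal{A})=\lambda(|\mathcal{A}|)$. -/

import Mathlib

/-- Real tensors of order `m` and dimension `n`: multi-arrays `(t_{i_1 ⋯ i_m})`, the index tuple
`(i_1, …, i_m)` being a function `Fin m → Fin n`. Addition, subtraction and the order are entrywise. -/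
abbrev RealTensor (m n : ℕ) : Type := (Fin m → Fin n) → ℝ

namespace RealTensor

variable {m n : ℕ}

/-- `D` is a diagonal tensor: an entry vanishes unless all its indices coincide. -/
def IsDiagonal (D : RealTensor m n) : Prop :=
  ∀ f : Fin m → Fin n, (∃ j k, f j ≠ f k) → D f = 0

/-- All diagonal entries `c_{i i ⋯ i}` vanish. -/
def HasZeroDiagonal (C : RealTensor m n) : Prop :=
  ∀ i : Fin n, C (fun _ => i) = 0

/-- The absolute tensor `|A| = (|a_{i_1 ⋯ i_m}|)`. -/
def absTensor (A : RealTensor m n) : RealTensor m n := fun f => |A f|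

/-- The number of the indices `i_1, …, i_m` that lie in `V`, counted with repetition. -/
def indexCount (V : Finset (Fin n)) (f : Fin m → Fin n) : ℕ :=
  (Finset.univ.filter (fun j => f j ∈ V)).card

/-- `A` is weakly even-bipartite corresponding to the nonempty proper index subset `V`: an entry
vanishes whenever the number of its indices in `V` is odd. -/
def IsWeaklyEvenBipartite (A : RealTensor m n) (V : Finset (Fin n)) : Prop :=
  V.Nonempty ∧ V ≠ Finset.univ ∧ ∀ f : Fin m → Fin n, Odd (indexCount V f) → A f = 0

/-- The vector `T x^{m-1}`, whose `i`-th coordinate is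
`∑_{i_2, …, i_m} t_{i i_2 ⋯ i_m} x_{i_2} ⋯ x_{i_m}` (the first index is the one at `0 : Fin m`). -/
def applyPow [NeZero m] (T : RealTensor m n) (x : Fin n → ℝ) (i : Fin n) : ℝ :=
  ∑ f : Fin m → Fin n with f 0 = i, T f * ∏ j : Fin m with j ≠ 0, x (f j)

/-- `μ` is an H-eigenvalue of `T`, with H-eigenvector `x`: `x` is a nonzero real vector with
`T x^{m-1} = μ x^{[m-1]}`. -/
def IsHEigenpair [NeZero m] (T : RealTensor m n) (μ : ℝ) (x : Fin n → ℝ) : Prop :=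
  x ≠ 0 ∧ ∀ i : Fin n, applyPow T x i = μ * x i ^ (m - 1)

/-- The set of H-eigenvalues of `T`. -/
def hEigenvalues [NeZero m] (T : RealTensor m n) : Set ℝ :=
  {μ | ∃ x : Fin n → ℝ, IsHEigenpair T μ x}

/-- The largest H-eigenvalue `λ(T)`. It is meaningful when the set of H-eigenvalues has a greatest
element, which is always asserted alongside. -/
noncomputable def largestHEigenvalue [NeZero m] (T : RealTensor m n) : ℝ :=
  sSup (hEigenvalues T)

end RealTensor

/-! Let `s` be `1` on `V` and `-1` off `V`. A nonzero entry of `C` has its first index in `V` and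
evenly many indices in `V`; as `m` is odd, oddly many lie off `V`, all in positions other than `0`.
Replacing `x` by `s x` thus flips the sign of every `C` term, while diagonal terms and `x i ^ (m -
1)` are unchanged because `m - 1` is even. So `x ↦ s x` exchanges the H-eigenvectors of `A` and
`|A|` (`applyPow_signOn_mul`), and the two spectra coincide. A largest element exists because the
spectrum is compact (`isCompact_hEigenvalues`) and, for `m ≥ 3`, contains a diagonal entry of `D`
(`hEigenvalues_nonempty`). -/

namespace RealTensor

variable {m n : ℕ}

/-- The sign vector that is `1` on `V` and `-1` off `V`. -/
def signOn (V : Finset (Fin n)) (k : Fin n) : ℝ := if k ∈ V then 1 else -1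

lemma signOn_mul_self (V : Finset (Fin n)) (k : Fin n) : signOn V k * signOn V k = 1 := by
  unfold signOn; split_ifs <;> norm_num

lemma signOn_pow_of_even (V : Finset (Fin n)) (k : Fin n) {p : ℕ} (hp : Even p) :
    signOn V k ^ p = 1 := by
  obtain ⟨q, rfl⟩ := hp
  rw [pow_add, ← mul_pow, signOn_mul_self, one_pow]

lemma prod_signOn (V : Finset (Fin n)) (f : Fin m → Fin n) :
    ∏ j, signOn V (f j) = (-1) ^ (m - indexCount V f) := by
  have hcard := Finset.card_filter_add_card_filter_not (s := (Finset.univ : Finset (Fin m)))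
    (fun j => f j ∈ V)
  rw [Finset.card_univ, Fintype.card_fin] at hcard
  have : m - indexCount V f = (Finset.univ.filter (fun j => f j ∉ V)).card := by
    unfold indexCount; omega
  rw [this]
  simp [signOn, Finset.prod_ite]

lemma card_filter_ne_zero [NeZero m] :
    (Finset.univ.filter (fun j : Fin m => j ≠ 0)).card = m - 1 := by
  rw [Finset.filter_ne', Finset.card_erase_of_mem (Finset.mem_univ _), Finset.card_univ,
    Fintype.card_fin]

/-- Position `0` carries the sign `1`, so omitting it does not change the full product. -/
lemma prod_ne_zero_signOn [NeZero m] (V : Finset (Fin n)) (f : Fin m → Fin n) (h0 : f 0 ∈ V) :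
    ∏ j : Fin m with j ≠ 0, signOn V (f j) = (-1) ^ (m - indexCount V f) := by
  rw [← prod_signOn, Finset.filter_ne',
    ← Finset.mul_prod_erase _ (fun j => signOn V (f j)) (Finset.mem_univ (0 : Fin m))]
  simp [signOn, h0]

lemma absTensor_sub_apply {D C : RealTensor m n} (hD : D.IsDiagonal) (hD0 : ∀ f, 0 ≤ D f)
    (hC0 : ∀ f, 0 ≤ C f) (hC : C.HasZeroDiagonal) [NeZero m] (f : Fin m → Fin n) :
    (D - C).absTensor f = D f + C f := by
  by_cases h : ∃ j k, f j ≠ f k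
  · simp [absTensor, hD f h, abs_of_nonneg (hC0 f)]
  · push Not at h
    have hf : C f = 0 := by
      rw [show f = fun _ => f 0 from funext fun j => h j 0]; exact hC _
    simp [absTensor, hf, abs_of_nonneg (hD0 f)]

lemma applyPow_signOn_mul [NeZero m] (hm : Odd m) {D C : RealTensor m n}
    (hD : D.IsDiagonal) (hD0 : ∀ f, 0 ≤ D f) (hC : C.HasZeroDiagonal) (hC0 : ∀ f, 0 ≤ C f)
    {V : Finset (Fin n)} (hV : C.IsWeaklyEvenBipartite V)
    (hslice : ∀ f : Fin m → Fin n, f 0 ∉ V → C f = 0) (x : Fin n → ℝ) (i : Fin n) :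
    applyPow (D - C) (fun k => signOn V k * x k) i = applyPow (D - C).absTensor x i := by
  refine Finset.sum_congr rfl fun f _ => ?_
  rw [absTensor_sub_apply hD hD0 hC0 hC, Finset.prod_mul_distrib, Pi.sub_apply]
  by_cases hCf : C f = 0
  · by_cases h : ∃ j k, f j ≠ f k
    · simp [hCf, hD f h]
    -- On the diagonal the `m - 1` signs are equal, and `m - 1` is even.
    · push Not at h
      rw [Finset.prod_congr rfl (fun j _ => by rw [h j 0]),
        Finset.prod_const, card_filter_ne_zero,
        signOn_pow_of_even V _ (Nat.Odd.sub_odd hm odd_one), hCf]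
      ring
  · have h : ∃ j k, f j ≠ f k := by
      by_contra h
      push Not at h
      apply hCf
      rw [show f = fun _ => f 0 from funext fun j => h j 0]; exact hC _
    have h0 : f 0 ∈ V := by
      by_contra h0; exact hCf (hslice f h0)
    have heven : Even (indexCount V f) := by
      rw [← Nat.not_odd_iff_even]; exact fun ho => hCf (hV.2.2 f ho)
    have hle : indexCount V f ≤ m :=
      (Finset.card_filter_le _ _).trans (by simp)
    have hodd : Odd (m - indexCount V f) := Nat.Odd.sub_even hle hm heven
    rw [prod_ne_zero_signOn V f h0, hodd.neg_one_pow, hD f h]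
    ring

lemma hEigenvalues_absTensor_eq [NeZero m] (hm : Odd m) {D C : RealTensor m n}
    (hD : D.IsDiagonal) (hD0 : ∀ f, 0 ≤ D f) (hC : C.HasZeroDiagonal) (hC0 : ∀ f, 0 ≤ C f)
    {V : Finset (Fin n)} (hV : C.IsWeaklyEvenBipartite V)
    (hslice : ∀ f : Fin m → Fin n, f 0 ∉ V → C f = 0) :
    (D - C).absTensor.hEigenvalues = (D - C).hEigenvalues := by
  have hinv (x : Fin n → ℝ) : (fun k => signOn V k * (signOn V k * x k)) = x := by
    ext k; rw [← mul_assoc, signOn_mul_self, one_mul]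
  have hne {x : Fin n → ℝ} (hx : x ≠ 0) : (fun k => signOn V k * x k) ≠ 0 := by
    intro h
    apply hx
    rw [← hinv x]
    ext k
    simpa using congrArg (signOn V k * ·) (congrFun h k)
  have hpow (x : Fin n → ℝ) (i : Fin n) : (signOn V i * x i) ^ (m - 1) = x i ^ (m - 1) := by
    rw [mul_pow, signOn_pow_of_even V i (Nat.Odd.sub_odd hm odd_one), one_mul]
  have key := applyPow_signOn_mul hm hD hD0 hC hC0 hV hslice
  ext μ
  constructor
  · rintro ⟨x, hx, h⟩
    exact ⟨fun k => signOn V k * x k, hne hx, fun i => by rw [key, h, hpow]⟩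
  · rintro ⟨x, hx, h⟩
    exact ⟨fun k => signOn V k * x k, hne hx, fun i => by rw [← key, hinv, h, hpow]⟩

lemma continuous_applyPow [NeZero m] (T : RealTensor m n) (i : Fin n) :
    Continuous fun x => applyPow T x i := by
  unfold applyPow; fun_prop

lemma applyPow_smul [NeZero m] (T : RealTensor m n) (c : ℝ) (x : Fin n → ℝ) (i : Fin n) :
    applyPow T (c • x) i = c ^ (m - 1) * applyPow T x i := by
  unfold applyPow
  rw [Finset.mul_sum]
  refine Finset.sum_congr rfl fun f _ => ?_
  simp only [Pi.smul_apply, smul_eq_mul]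
  rw [Finset.prod_mul_distrib, Finset.prod_const, card_filter_ne_zero]
  ring

/-- Every H-eigenvalue has an H-eigenvector of sup norm one. -/
lemma exists_isHEigenpair_norm_one [NeZero m] {T : RealTensor m n} {μ : ℝ}
    (hμ : μ ∈ T.hEigenvalues) : ∃ x, ‖x‖ = 1 ∧ IsHEigenpair T μ x := by
  obtain ⟨x, hx, h⟩ := hμ
  have hn : ‖x‖ ≠ 0 := norm_ne_zero_iff.2 hx
  refine ⟨‖x‖⁻¹ • x, ?_, smul_ne_zero (inv_ne_zero hn) hx, fun i => ?_⟩
  · rw [norm_smul, norm_inv, norm_norm, inv_mul_cancel₀ hn]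
  · rw [applyPow_smul, h, Pi.smul_apply, smul_eq_mul, mul_pow]
    ring

/-- Read the eigenvalue equation at a coordinate of maximal modulus of a normalized eigenvector. -/
lemma abs_le_of_mem_hEigenvalues [NeZero m] {T : RealTensor m n} {μ : ℝ}
    (hμ : μ ∈ T.hEigenvalues) : |μ| ≤ ∑ f, |T f| := by
  obtain ⟨x, hx, hx0, h⟩ := exists_isHEigenpair_norm_one hμ
  have : Nonempty (Fin n) := by
    by_contra hn
    rw [not_nonempty_iff] at hn
    exact hx0 (Subsingleton.elim _ _)
  obtain ⟨i, hmax⟩ := Finite.exists_max fun i => ‖x i‖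
  have hi : ‖x i‖ = ‖x‖ :=
    le_antisymm (norm_le_pi_norm x i) ((pi_norm_le_iff_of_nonneg (norm_nonneg _)).2 hmax)
  have hxi : |x i| = 1 := by rw [← Real.norm_eq_abs, hi, hx]
  have habs : |μ| = |applyPow T x i| := by rw [h i, abs_mul, abs_pow, hxi, one_pow, mul_one]
  rw [habs]
  calc |applyPow T x i|
      ≤ ∑ f : Fin m → Fin n with f 0 = i, |T f * ∏ j : Fin m with j ≠ 0, x (f j)| :=
        Finset.abs_sum_le_sum_abs _ _
    _ ≤ ∑ f : Fin m → Fin n with f 0 = i, |T f| := by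
        refine Finset.sum_le_sum fun f _ => ?_
        rw [abs_mul, Finset.abs_prod]
        refine mul_le_of_le_one_right (abs_nonneg _)
          (Finset.prod_le_one (fun _ _ => abs_nonneg _) fun j _ => ?_)
        rw [← hx, ← Real.norm_eq_abs]
        exact norm_le_pi_norm x (f j)
    _ ≤ ∑ f, |T f| :=
        Finset.sum_le_sum_of_subset_of_nonneg (Finset.filter_subset _ _)
          fun _ _ _ => abs_nonneg _

/-- The spectrum is the projection of a closed set of pairs (eigenvalue, unit eigenvector) inside a
compact box times sphere. -/
lemma isCompact_hEigenvalues [NeZero m] (T : RealTensor m n) : IsCompact T.hEigenvalues := by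
  set B := ∑ f, |T f|
  have hK : IsCompact ((Set.Icc (-B) B ×ˢ Metric.sphere (0 : Fin n → ℝ) 1) ∩
      {p : ℝ × (Fin n → ℝ) | ∀ i, applyPow T p.2 i = p.1 * p.2 i ^ (m - 1)}) := by
    refine (isCompact_Icc.prod (isCompact_sphere _ _)).inter_right ?_
    simp only [Set.ofPred_forall]
    refine isClosed_iInter fun i => isClosed_eq ?_ (by fun_prop)
    exact (continuous_applyPow T i).comp continuous_snd
  convert hK.image continuous_fst using 1
  ext μ
  constructor
  · intro hμ
    obtain ⟨x, hx, -, h⟩ := exists_isHEigenpair_norm_one hμ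
    exact ⟨(μ, x), ⟨⟨abs_le.1 (abs_le_of_mem_hEigenvalues hμ), by simpa using hx⟩, h⟩, rfl⟩
  · rintro ⟨⟨ν, x⟩, ⟨⟨-, hx⟩, h⟩, rfl⟩
    refine ⟨x, ?_, h⟩
    rintro rfl
    simp at hx

lemma isGreatest_largestHEigenvalue [NeZero m] {T : RealTensor m n}
    (hT : T.hEigenvalues.Nonempty) : IsGreatest T.hEigenvalues T.largestHEigenvalue :=
  (isCompact_hEigenvalues T).isGreatest_sSup hT

lemma applyPow_single [NeZero m] (T : RealTensor m n) (i k : Fin n) :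
    applyPow T (Pi.single i 1) k = T (Function.update (fun _ => i) 0 k) := by
  unfold applyPow
  rw [Finset.sum_eq_single (Function.update (fun _ => i) 0 k)]
  · rw [Finset.prod_eq_one, mul_one]
    intro j hj
    simp [Function.update_of_ne (Finset.mem_filter.1 hj).2]
  · intro f hf hne
    have hf0 : f 0 = k := (Finset.mem_filter.1 hf).2
    obtain ⟨j, hj⟩ := Function.ne_iff.1 hne
    have hj0 : j ≠ 0 := by
      rintro rfl
      simp [hf0] at hj
    rw [Function.update_of_ne hj0] at hj
    rw [Finset.prod_eq_zero (Finset.mem_filter.2 ⟨Finset.mem_univ j, hj0⟩)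
      (Pi.single_eq_of_ne hj _), mul_zero]
  · simp

/-- A unit vector is an H-eigenvector of a tensor of order at least two if the entries
`t_{k i ⋯ i}` with `k ≠ i` vanish. -/
lemma isHEigenpair_single [NeZero m] (hm : m ≠ 1) {T : RealTensor m n} {i : Fin n}
    (h : ∀ k, k ≠ i → T (Function.update (fun _ => i) 0 k) = 0) :
    IsHEigenpair T (T fun _ => i) (Pi.single i 1) := by
  have hm0 : m ≠ 0 := NeZero.ne m
  refine ⟨by simp, fun k => ?_⟩
  rw [applyPow_single]
  by_cases hk : k = i
  · subst hk
    simp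
  -- Order one is excluded because there `0 ^ (m - 1)` would be `1`.
  · rw [h k hk, Pi.single_eq_of_ne hk, zero_pow (by omega), mul_zero]

/-- For `i ∈ V` the unit vector at `i` is an eigenvector: an entry `c_{k i ⋯ i}` vanishes by parity
if `k ∈ V` (all `m` indices lie in `V`) and by the slice condition otherwise. -/
lemma hEigenvalues_nonempty [NeZero m] (hm : Odd m) (hm1 : m ≠ 1) {D C : RealTensor m n}
    (hD : D.IsDiagonal) {V : Finset (Fin n)} (hV : C.IsWeaklyEvenBipartite V)
    (hslice : ∀ f : Fin m → Fin n, f 0 ∉ V → C f = 0) : (D - C).hEigenvalues.Nonempty := by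
  obtain ⟨i, hi⟩ := hV.1
  refine ⟨_, _, isHEigenpair_single hm1 (i := i) fun k hk => ?_⟩
  have hm2 : 1 < m := by have := NeZero.ne m; omega
  have hDz : D (Function.update (fun _ => i) 0 k) = 0 := by
    refine hD _ ⟨0, ⟨1, hm2⟩, ?_⟩
    rw [Function.update_self, Function.update_of_ne (by simp [Fin.ext_iff])]
    exact hk
  have hCz : C (Function.update (fun _ => i) 0 k) = 0 := by
    by_cases hkV : k ∈ V
    · apply hV.2.2
      have hall : ∀ j, Function.update (fun _ : Fin m => i) 0 k j ∈ V := fun j => by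
        rw [Function.update_apply]; split_ifs <;> assumption
      simpa [indexCount, hall] using hm
    · exact hslice _ (by simpa using hkV)
  rw [Pi.sub_apply, hDz, hCz, sub_zero]

end RealTensor

theorem mainTheorem8 {m n : ℕ} [NeZero m] (hm : Odd m)
    (A D C : RealTensor m n)
    (hD : D.IsDiagonal) (hD0 : ∀ f, 0 ≤ D f)
    (hC : C.HasZeroDiagonal) (hC0 : ∀ f, 0 ≤ C f)
    (hA : A = D - C)
    -- existence of H-eigenvalues is assumed only in the degenerate order one, where `|A| = A`
    (hex : m = 1 → A.hEigenvalues.Nonempty)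
    (V : Finset (Fin n)) (hV : C.IsWeaklyEvenBipartite V)
    (hslice : ∀ f : Fin m → Fin n, f 0 ∉ V → C f = 0) :
    IsGreatest A.hEigenvalues A.largestHEigenvalue ∧
    IsGreatest A.absTensor.hEigenvalues A.absTensor.largestHEigenvalue ∧
    A.largestHEigenvalue = A.absTensor.largestHEigenvalue := by
  subst hA
  have heq := RealTensor.hEigenvalues_absTensor_eq hm hD hD0 hC hC0 hV hslice
  have hne : (D - C).hEigenvalues.Nonempty := by
    by_cases hm1 : m = 1
    · exact hex hm1
    · exact RealTensor.hEigenvalues_nonempty hm hm1 hD hV hslice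
  refine ⟨RealTensor.isGreatest_largestHEigenvalue hne,
    RealTensor.isGreatest_largestHEigenvalue (heq ▸ hne), ?_⟩
  unfold RealTensor.largestHEigenvalue
  rw [heq]
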